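/- Let $q$ be a complex number with $0<|q|<1$. Put $$(x;q)_n=\prod_{i=0}^{n-1}(1-xq^i),\qquad (x;q)_\infty=\prod_{i=0}^{\infty}(1-xq^i),\qquad (x_1,\dots,x_r;q)_n=(x_1;q)_n\cdots(x_r;q)_n$$ for $n\in\{0,1,2,\dots\}\cup\{\infty\}$, let $$\theta(q,x)=\sum_{n=0}^{\infty}(-1)^nq^{\binom n2}x^n ,$$ and let $$P(a,b)=P_3(a,b)=(q,a,b;q)_\infty\sum_{n=0}^{\infty}\frac{(ab/q^3;q)_{2n}}{(q,a,b,ab/q^3;q)_n}\,q^n .$$ Let $a,b$ be complex numbers with $a\neq0$, $b\neq0$ and $a+b\neq0$. Then all the infinite products and series involved converge, and $$\frac{a(b+q)}{b(1+q)}\theta(q,a)-\frac{b(a+q)}{a(1+q)}\theta(q,b)+\frac{b+q^2}{a+b}\theta(q,a/q)-\frac{a+q^2}{a+b}\theta(q,b/q)=-\frac{(a-b)(a-bq)(b-aq)}{ab(a+b)(1+q)}\,P(a,b).$$ Here the formula for $P(a,b)$ is taken literally when none of its denominators vanishes, i.e. when $aq^k\neq1$, $bq^k\neq1$ and $(ab/q^3)q^k\neq1$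 for all integers $k\ge0$. For the remaining $a,b$, where these singularities are removable, $P(a,b)$ denotes the value after cancellation, $$P(a,b)=\sum_{n=0}^{\infty}(q^{n+1},aq^n,bq^n;q)_\infty\,(abq^{n-3};q)_n\,q^n ,$$ and the identity with this cancelled expression for $P(a,b)$ holds for all $a,b$ with $ab(a+b)\ne0$. -/

import Mathlib

namespace PartialTheta

noncomputable section

/-- The finite `q`-shifted factorial `(x;q)_n = ∏_{i<n} (1 - x q^i)`. -/
def qPoch (x q : ℂ) (n : ℕ) : ℂ := ∏ i ∈ Finset.range n, (1 - x * q ^ i)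

/-- The infinite `q`-shifted factorial `(x;q)_∞ = ∏_{i≥0} (1 - x q^i)`. -/
def qPochInf (x q : ℂ) : ℂ := ∏' i : ℕ, (1 - x * q ^ i)

/-- The `n`-th term of the partial theta series. -/
def thetaTerm (q x : ℂ) (n : ℕ) : ℂ := (-1) ^ n * q ^ (n.choose 2) * x ^ n

/-- The partial theta function `θ(q,x) = ∑_{n≥0} (-1)^n q^{n(n-1)/2} x^n`. -/
def theta (q x : ℂ) : ℂ := ∑' n : ℕ, thetaTerm q x n

/-- The `n`-th term `(ab/q^m;q)_{2n} q^n / (q,a,b,ab/q^m;q)_n` of the series in `P_m(a,b)`. -/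
def PTerm (m : ℕ) (q a b : ℂ) (n : ℕ) : ℂ :=
  qPoch (a * b / q ^ m) q (2 * n) /
    (qPoch q q n * qPoch a q n * qPoch b q n * qPoch (a * b / q ^ m) q n) * q ^ n

/-- `P_m(a,b) = (q,a,b;q)_∞ ∑_{n≥0} (ab/q^m;q)_{2n} q^n / (q,a,b,ab/q^m;q)_n`.
The formula is meaningful when no denominator vanishes. -/
def P (m : ℕ) (q a b : ℂ) : ℂ :=
  qPochInf q q * qPochInf a q * qPochInf b q * ∑' n : ℕ, PTerm m q a b n

/-- The `n`-th term of `P_m(a,b)`, prefactor included, after cancelling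
`(x;q)_∞ / (x;q)_n = (x q^n;q)_∞` for `x = q, a, b` and `(x;q)_{2n} / (x;q)_n = (x q^n;q)_n` for
`x = ab/q^m`. -/
def PRegTerm (m : ℕ) (q a b : ℂ) (n : ℕ) : ℂ :=
  qPochInf (q * q ^ n) q * qPochInf (a * q ^ n) q * qPochInf (b * q ^ n) q *
    qPoch (a * b / q ^ m * q ^ n) q n * q ^ n

/-- `P_m(a,b)` with the removable singularities (zero denominators) removed: it is meaningful for
all complex `a`, `b`, and has the same value as `P m q a b` where no denominator vanishes. -/
def PReg (m : ℕ) (q a b : ℂ) : ℂ := ∑' n : ℕ, PRegTerm m q a b n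

/-- The combination of partial theta functions on the left-hand side of the identity. -/
def thetaCombination (q a b : ℂ) : ℂ :=
  a * (b + q) / (b * (1 + q)) * theta q a - b * (a + q) / (a * (1 + q)) * theta q b
    + (b + q ^ 2) / (a + b) * theta q (a / q) - (a + q ^ 2) / (a + b) * theta q (b / q)

end

end PartialTheta

/-! Write P_m for `PReg m`. Contiguity, `(b-a) P_{m+1}(a,b) = b P_m(a/q,b) - a P_m(a,b/q)`, reduces
P_3 to P_1. The base case is the product P_1(a,b) = θ(a)θ(b) (`PReg_one_eq`): a recurrence in `a`
makes P_1 satisfy the functional equation of θ up to the constant P_1(0,b). By symmetry that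
constant is P_1(0,0)θ(b), and P_1(0,0) = 1 telescopes. With θ(x/q) = 1 - (x/q)θ(x), the products
θ(a)θ(b) cancel in P_2, so P_2 and then P_3 are linear in theta values. -/

namespace PartialTheta

open Filter Topology

/-! ### Bounds and shift rules for `q`-factorials -/

section Pochhammer

variable {q : ℂ}

lemma summable_norm_mul_pow (hq : ‖q‖ < 1) (x : ℂ) : Summable fun i : ℕ => ‖-(x * q ^ i)‖ := by
  simpa [norm_mul, norm_pow] using
    (summable_geometric_of_lt_one (norm_nonneg q) hq).mul_left ‖x‖

lemma tsum_norm_mul_pow (hq : ‖q‖ < 1) (x : ℂ) :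
    ∑' i : ℕ, ‖-(x * q ^ i)‖ = ‖x‖ / (1 - ‖q‖) := by
  simp [norm_pow, tsum_mul_left, tsum_geometric_of_lt_one (norm_nonneg q) hq,
    div_eq_mul_inv]

lemma multipliable_one_sub_mul_pow (hq : ‖q‖ < 1) (x : ℂ) :
    Multipliable fun i : ℕ => 1 - x * q ^ i := by
  simpa [sub_eq_add_neg] using multipliable_one_add_of_summable (summable_norm_mul_pow hq x)

lemma norm_qPoch_sub_one_le (hq : ‖q‖ < 1) (x : ℂ) (n : ℕ) :
    ‖qPoch x q n - 1‖ ≤ Real.exp (‖x‖ / (1 - ‖q‖)) - 1 := by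
  have h := Finset.norm_prod_one_add_sub_one_le (Finset.range n) fun i => -(x * q ^ i)
  have h' := (summable_norm_mul_pow hq x).sum_le_tsum (Finset.range n) fun i _ => norm_nonneg _
  rw [tsum_norm_mul_pow hq] at h'
  simp only [← sub_eq_add_neg] at h
  exact h.trans (sub_le_sub_right (Real.exp_le_exp.mpr h') 1)

lemma tendsto_qPoch (hq : ‖q‖ < 1) (x : ℂ) :
    Tendsto (qPoch x q) atTop (𝓝 (qPochInf x q)) :=
  (multipliable_one_sub_mul_pow hq x).hasProd.tendsto_prod_nat

lemma norm_qPochInf_sub_one_le (hq : ‖q‖ < 1) (x : ℂ) :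
    ‖qPochInf x q - 1‖ ≤ Real.exp (‖x‖ / (1 - ‖q‖)) - 1 :=
  le_of_tendsto ((tendsto_qPoch hq x).sub_const 1).norm
    (Eventually.of_forall fun n => norm_qPoch_sub_one_le hq x n)

lemma norm_le_of_norm_sub_one_le {z : ℂ} {r : ℝ} (h : ‖z - 1‖ ≤ r - 1) : ‖z‖ ≤ r := by
  have h1 : ‖z‖ ≤ ‖z - 1‖ + ‖(1 : ℂ)‖ := by simpa using norm_add_le (z - 1) 1
  rw [norm_one] at h1
  linarith

lemma norm_qPoch_le (hq : ‖q‖ < 1) (x : ℂ) (n : ℕ) :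
    ‖qPoch x q n‖ ≤ Real.exp (‖x‖ / (1 - ‖q‖)) :=
  norm_le_of_norm_sub_one_le (norm_qPoch_sub_one_le hq x n)

lemma norm_qPochInf_le (hq : ‖q‖ < 1) (x : ℂ) :
    ‖qPochInf x q‖ ≤ Real.exp (‖x‖ / (1 - ‖q‖)) :=
  norm_le_of_norm_sub_one_le (norm_qPochInf_sub_one_le hq x)

@[simp] lemma qPoch_zero_left (n : ℕ) : qPoch 0 q n = 1 := by simp [qPoch]

@[simp] lemma qPochInf_zero_left : qPochInf 0 q = 1 := by simp [qPochInf]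

lemma tendsto_qPochInf_zero (hq : ‖q‖ < 1) :
    Tendsto (fun x => qPochInf x q) (𝓝 0) (𝓝 1) := by
  rw [tendsto_iff_norm_sub_tendsto_zero]
  have hc : Continuous fun x : ℂ => Real.exp (‖x‖ / (1 - ‖q‖)) - 1 := by fun_prop
  refine squeeze_zero (fun _ => norm_nonneg _) (fun x => norm_qPochInf_sub_one_le hq x) ?_
  simpa using hc.tendsto 0

lemma continuous_qPoch (n : ℕ) : Continuous fun x => qPoch x q n := by
  unfold qPoch
  fun_prop

lemma qPoch_succ (x : ℂ) (n : ℕ) : qPoch x q (n + 1) = qPoch x q n * (1 - x * q ^ n) :=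
  Finset.prod_range_succ _ _

lemma qPoch_add (x : ℂ) (m n : ℕ) :
    qPoch x q (m + n) = qPoch x q m * qPoch (x * q ^ m) q n := by
  simp only [qPoch, Finset.prod_range_add, pow_add, mul_assoc]

lemma qPoch_succ_left (x : ℂ) (n : ℕ) :
    qPoch x q (n + 1) = (1 - x) * qPoch (x * q) q n := by
  rw [add_comm, qPoch_add]
  simp [qPoch]

lemma qPochInf_eq_qPoch_mul (hq : ‖q‖ < 1) (x : ℂ) (n : ℕ) :
    qPochInf x q = qPoch x q n * qPochInf (x * q ^ n) q := by
  have h := (multipliable_one_sub_mul_pow hq (x * q ^ n)).congr fun i => by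
    show 1 - x * q ^ n * q ^ i = 1 - x * q ^ (i + n)
    ring
  have h' := h.prod_mul_tprod_nat_mul' (f := fun i => 1 - x * q ^ i)
  rw [qPochInf, ← h', qPoch, qPochInf]
  congr 2
  ext i
  ring

lemma qPochInf_eq_one_sub_mul (hq : ‖q‖ < 1) (x : ℂ) :
    qPochInf x q = (1 - x) * qPochInf (x * q) q := by
  simpa [qPoch] using qPochInf_eq_qPoch_mul hq x 1

lemma tendsto_mul_pow (hq : ‖q‖ < 1) (x : ℂ) :
    Tendsto (fun n : ℕ => x * q ^ n) atTop (𝓝 0) := by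
  simpa using (tendsto_pow_atTop_nhds_zero_of_norm_lt_one hq).const_mul x

lemma qPoch_ne_zero {x : ℂ} (hx : ∀ k : ℕ, x * q ^ k ≠ 1) (n : ℕ) : qPoch x q n ≠ 0 :=
  Finset.prod_ne_zero_iff.mpr fun i _ => sub_ne_zero.mpr (hx i).symm

/-- The tails `(x q^n;q)_∞` tend to 1, so some tail is nonzero; only finitely many factors remain.
-/
lemma qPochInf_ne_zero (hq : ‖q‖ < 1) {x : ℂ} (hx : ∀ k : ℕ, x * q ^ k ≠ 1) :
    qPochInf x q ≠ 0 := by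
  have h := ((tendsto_qPochInf_zero hq).comp (tendsto_mul_pow hq x)).eventually_ne one_ne_zero
  obtain ⟨n, hn⟩ := h.exists
  rw [qPochInf_eq_qPoch_mul hq x n]
  exact mul_ne_zero (qPoch_ne_zero hx n) hn

lemma self_mul_pow_ne_one (hq : ‖q‖ < 1) (k : ℕ) : q * q ^ k ≠ 1 := by
  intro h
  have h1 : ‖q ^ (k + 1)‖ < 1 := by
    rw [norm_pow]
    exact pow_lt_one₀ (norm_nonneg q) hq k.succ_ne_zero
  rw [pow_succ', h, norm_one] at h1
  exact lt_irrefl _ h1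

end Pochhammer

/-! ### The functional equation of θ -/

section Theta

variable {q : ℂ}

lemma thetaTerm_succ (q x : ℂ) (n : ℕ) :
    thetaTerm q x (n + 1) = -(x * q ^ n) * thetaTerm q x n := by
  simp only [thetaTerm, Nat.choose_succ_succ' n 1, Nat.choose_one_right, pow_add]
  ring

lemma thetaTerm_succ_left (q x : ℂ) (n : ℕ) :
    thetaTerm q x (n + 1) = -x * thetaTerm q (x * q) n := by
  simp only [thetaTerm, Nat.choose_succ_succ' n 1, Nat.choose_one_right, pow_add, mul_pow]
  ring

lemma summable_thetaTerm (hq : ‖q‖ < 1) (x : ℂ) : Summable (thetaTerm q x) := by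
  have h : ∀ᶠ n : ℕ in atTop, ‖-(x * q ^ n)‖ < 1 / 2 := by
    have h0 := (tendsto_mul_pow hq x).neg.norm
    simp only [neg_zero, norm_zero] at h0
    exact h0.eventually_lt_const (by norm_num)
  refine summable_of_ratio_norm_eventually_le (r := 1 / 2) (by norm_num) ?_
  filter_upwards [h] with n hn
  rw [thetaTerm_succ, norm_mul]
  exact mul_le_mul_of_nonneg_right hn.le (norm_nonneg _)

lemma theta_eq_one_sub (hq : ‖q‖ < 1) (x : ℂ) : theta q x = 1 - x * theta q (x * q) := by
  rw [theta, (summable_thetaTerm hq x).tsum_eq_zero_add]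
  simp only [thetaTerm_succ_left, tsum_mul_left]
  simp [thetaTerm, theta]
  ring

/-- The equation `f x = c - x f(xq)`, together with convergence at `0`, determines `f`. -/
lemma eq_mul_theta_of_functional_equation (hq : ‖q‖ < 1) {f : ℂ → ℂ} {c l : ℂ}
    (hf : ∀ x, f x = c - x * f (x * q)) (hl : Tendsto f (𝓝 0) (𝓝 l)) (x : ℂ) :
    f x = c * theta q x := by
  -- Iterating the equation `n` times builds the partial sums of θ; the remainder vanishes because
  -- `f (x * q ^ n)` converges.
  have key (n : ℕ) : f x =
      c * ∑ i ∈ Finset.range n, thetaTerm q x i + thetaTerm q x n * f (x * q ^ n) := by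
    induction n with
    | zero => simp [thetaTerm]
    | succ n ih =>
      rw [ih, hf (x * q ^ n), Finset.sum_range_succ, thetaTerm_succ, pow_succ, ← mul_assoc]
      ring
  have hs := summable_thetaTerm hq x
  have h := (hs.hasSum.tendsto_sum_nat.const_mul c).add
    (hs.tendsto_atTop_zero.mul (hl.comp (tendsto_mul_pow hq x)))
  rw [zero_mul, add_zero] at h
  exact tendsto_nhds_unique (tendsto_const_nhds.congr key) h

end Theta

/-! ### The series P_m: contiguity, product formula, evaluation -/

section PReg

variable {q : ℂ}

lemma norm_PRegTerm_le (hq : ‖q‖ < 1) (m : ℕ) (a b : ℂ) (n : ℕ) :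
    ‖PRegTerm m q a b n‖ ≤
      Real.exp (‖q‖ / (1 - ‖q‖)) * Real.exp (‖a‖ / (1 - ‖q‖)) * Real.exp (‖b‖ / (1 - ‖q‖)) *
        Real.exp (‖a * b / q ^ m‖ / (1 - ‖q‖)) * ‖q‖ ^ n := by
  have h (x : ℂ) : Real.exp (‖x * q ^ n‖ / (1 - ‖q‖)) ≤ Real.exp (‖x‖ / (1 - ‖q‖)) := by
    have h0 : 0 ≤ 1 - ‖q‖ := by linarith
    have h1 : ‖x * q ^ n‖ ≤ ‖x‖ := by
      rw [norm_mul, norm_pow]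
      exact mul_le_of_le_one_right (norm_nonneg x) (pow_le_one₀ (norm_nonneg q) hq.le)
    gcongr
  have h1 (x : ℂ) := (norm_qPochInf_le hq (x * q ^ n)).trans (h x)
  have h2 (x : ℂ) := (norm_qPoch_le hq (x * q ^ n) n).trans (h x)
  simp only [PRegTerm, norm_mul (_ * _), norm_mul (qPochInf _ _), norm_pow]
  gcongr
  exacts [h1 q, h1 a, h1 b, h2 _]

lemma summable_PRegTerm (hq : ‖q‖ < 1) (m : ℕ) (a b : ℂ) : Summable (PRegTerm m q a b) :=
  .of_norm_bounded ((summable_geometric_of_lt_one (norm_nonneg q) hq).mul_left _)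
    (norm_PRegTerm_le hq m a b)

lemma PReg_comm (m : ℕ) (q a b : ℂ) : PReg m q a b = PReg m q b a := by
  unfold PReg PRegTerm
  congr 1
  ext n
  rw [mul_comm a b]
  ring

lemma tendsto_PReg_zero (hq : ‖q‖ < 1) (m : ℕ) (b : ℂ) :
    Tendsto (fun a => PReg m q a b) (𝓝 0) (𝓝 (PReg m q 0 b)) := by
  refine tendsto_tsum_of_dominated_convergence
    (bound := fun n => Real.exp (‖q‖ / (1 - ‖q‖)) * Real.exp (1 / (1 - ‖q‖)) *
      Real.exp (‖b‖ / (1 - ‖q‖)) * Real.exp (‖b / q ^ m‖ / (1 - ‖q‖)) * ‖q‖ ^ n)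
    ((summable_geometric_of_lt_one (norm_nonneg q) hq).mul_left _) (fun n => ?_) ?_
  · have h1 : Tendsto (fun a : ℂ => a * q ^ n) (𝓝 0) (𝓝 0) := by
      simpa using (continuous_mul_const (q ^ n)).tendsto (0 : ℂ)
    have h2 : Continuous fun a : ℂ => qPoch (a * b / q ^ m * q ^ n) q n :=
      (continuous_qPoch n).comp
        (((continuous_mul_const b).div_const (q ^ m)).mul continuous_const)
    have h3 : Tendsto (fun a : ℂ => qPochInf (a * q ^ n) q) (𝓝 0)
        (𝓝 (qPochInf (0 * q ^ n) q)) := by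
      simpa [Function.comp_def] using (tendsto_qPochInf_zero hq).comp h1
    exact (((h3.const_mul _).mul_const _).mul (h2.tendsto 0)).mul_const _
  -- On `‖a‖ ≤ 1` the termwise bound no longer depends on `a`.
  · filter_upwards [Metric.closedBall_mem_nhds (0 : ℂ) one_pos] with a ha n
    rw [mem_closedBall_zero_iff] at ha
    have h0 : 0 ≤ 1 - ‖q‖ := by linarith
    refine (norm_PRegTerm_le hq m a b n).trans ?_
    have h1 : ‖a * b / q ^ m‖ ≤ ‖b / q ^ m‖ := by
      rw [mul_div_assoc, norm_mul]
      exact mul_le_of_le_one_left (norm_nonneg _) ha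
    gcongr

/-- Contiguity: the series `P_{m+1}` is a combination of two series `P_m`. -/
lemma sub_mul_PReg_succ (hq0 : q ≠ 0) (hq : ‖q‖ < 1) (m : ℕ) (a b : ℂ) :
    (b - a) * PReg (m + 1) q a b = b * PReg m q (a / q) b - a * PReg m q a (b / q) := by
  unfold PReg
  rw [← tsum_mul_left, ← tsum_mul_left, ← tsum_mul_left,
    ← ((summable_PRegTerm hq m _ _).mul_left b).tsum_sub
      ((summable_PRegTerm hq m _ _).mul_left a)]
  congr 1
  ext n
  have h (x : ℂ) : qPochInf (x / q * q ^ n) q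
      = (1 - x / q * q ^ n) * qPochInf (x * q ^ n) q := by
    rw [qPochInf_eq_one_sub_mul hq]
    congr 2
    field_simp
  have e1 : a / q * b / q ^ m = a * b / q ^ (m + 1) := by field_simp; ring
  have e2 : a * (b / q) / q ^ m = a * b / q ^ (m + 1) := by field_simp; ring
  simp only [PRegTerm, h, e1, e2]
  -- After removing common factors: `b(1 - a q^(n-1)) - a(1 - b q^(n-1)) = b - a`.
  ring

lemma PRegTerm_one_zero (hq : ‖q‖ < 1) (a b : ℂ) :
    PRegTerm 1 q a b 0 = (1 - a) * PRegTerm 1 q (a * q) b 0 := by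
  simp only [PRegTerm, pow_zero, mul_one, qPochInf_eq_one_sub_mul hq a]
  simp only [qPoch, Finset.range_zero, Finset.prod_empty]
  ring

/-- Dividing out the common factors leaves `(1 - aq^(n+1))(1 - abq^n) = (1 - a)(1 - abq^(2n+1)) +
a(1 - q^(n+1))(1 - bq^n)`. -/
lemma PRegTerm_one_succ (hq0 : q ≠ 0) (hq : ‖q‖ < 1) (a b : ℂ) (n : ℕ) :
    PRegTerm 1 q a b (n + 1) =
      (1 - a) * PRegTerm 1 q (a * q) b (n + 1) + a * q * PRegTerm 1 q (a * q * q) b n := by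
  have e1 : a * b / q * q ^ (n + 1) = a * b * q ^ n := by field_simp; ring
  have e2 : a * q * b / q * q ^ (n + 1) = a * b * q ^ n * q := by field_simp; ring
  have e3 : a * q * q * b / q * q ^ n = a * b * q ^ n * q := by field_simp
  have e4 : a * q ^ (n + 1) * q = a * q * q * q ^ n := by ring
  have e5 : a * q * q ^ (n + 1) = a * q * q * q ^ n := by ring
  have e6 : q * q ^ n * q = q * q ^ (n + 1) := by ring
  have e7 : b * q ^ n * q = b * q ^ (n + 1) := by ring
  simp only [PRegTerm, pow_one, e1, e2, e3, e5]
  rw [qPochInf_eq_one_sub_mul hq (a * q ^ (n + 1)), qPochInf_eq_one_sub_mul hq (q * q ^ n),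
    qPochInf_eq_one_sub_mul hq (b * q ^ n), qPoch_succ_left (a * b * q ^ n),
    qPoch_succ (a * b * q ^ n * q), e4, e6, e7]
  ring

lemma PReg_one_recurrence (hq0 : q ≠ 0) (hq : ‖q‖ < 1) (a b : ℂ) :
    PReg 1 q a b = (1 - a) * PReg 1 q (a * q) b + a * q * PReg 1 q (a * q * q) b := by
  have s (a : ℂ) := summable_PRegTerm hq 1 a b
  unfold PReg
  rw [(s a).tsum_eq_zero_add, (s (a * q)).tsum_eq_zero_add, PRegTerm_one_zero hq]
  simp only [PRegTerm_one_succ hq0 hq a b]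
  rw [(((summable_nat_add_iff 1).mpr (s (a * q))).mul_left _).tsum_add ((s _).mul_left _),
    tsum_mul_left, tsum_mul_left]
  ring

/-- By the recurrence, `P_1(a,b) + a P_1(aq,b)` is unchanged under `a ↦ aq`, so it equals its limit
at `a = 0`. -/
lemma PReg_one_add_eq (hq0 : q ≠ 0) (hq : ‖q‖ < 1) (a b : ℂ) :
    PReg 1 q a b = PReg 1 q 0 b - a * PReg 1 q (a * q) b := by
  have key (n : ℕ) : PReg 1 q a b + a * PReg 1 q (a * q) b =
      PReg 1 q (a * q ^ n) b + a * q ^ n * PReg 1 q (a * q ^ n * q) b := by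
    induction n with
    | zero => simp
    | succ n ih =>
      rw [ih, PReg_one_recurrence hq0 hq (a * q ^ n) b]
      simp only [pow_succ, ← mul_assoc]
      ring
  have t := tendsto_mul_pow hq a
  have t' : Tendsto (fun n : ℕ => a * q ^ n * q) atTop (𝓝 0) := by simpa using t.mul_const q
  have p := tendsto_PReg_zero hq 1 b
  have h := (p.comp t).add (t.mul (p.comp t'))
  rw [zero_mul, add_zero] at h
  exact eq_sub_of_add_eq (tendsto_nhds_unique (tendsto_const_nhds.congr key) h)

lemma PReg_zero_zero (hq : ‖q‖ < 1) (m : ℕ) : PReg m q 0 0 = 1 := by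
  -- The terms telescope, starting from `(1;q)_∞ = 0`.
  have e (n : ℕ) : PRegTerm m q 0 0 n = qPochInf (q ^ (n + 1)) q - qPochInf (q ^ n) q := by
    rw [qPochInf_eq_one_sub_mul hq (q ^ n), ← pow_succ]
    simp only [PRegTerm, zero_mul, zero_div, qPochInf_zero_left, qPoch_zero_left, ← pow_succ']
    ring
  have h0 : qPochInf (q ^ 0) q = 0 := by rw [qPochInf_eq_one_sub_mul hq]; simp
  have h := (summable_PRegTerm hq m 0 0).hasSum.tendsto_sum_nat
  simp only [e, Finset.sum_range_sub (fun n => qPochInf (q ^ n) q), h0, sub_zero] at h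
  have h1 := (tendsto_qPochInf_zero hq).comp (tendsto_pow_atTop_nhds_zero_of_norm_lt_one hq)
  exact (tendsto_nhds_unique h1 (by simpa [PReg, e, Function.comp_def] using h)).symm

/-- The product formula of Andrews and Warnaar for partial theta functions. -/
lemma PReg_one_eq (hq0 : q ≠ 0) (hq : ‖q‖ < 1) (a b : ℂ) :
    PReg 1 q a b = theta q a * theta q b := by
  have h0 : PReg 1 q 0 b = theta q b := by
    have h := eq_mul_theta_of_functional_equation hq
      (fun x => PReg_one_add_eq hq0 hq x 0) (tendsto_PReg_zero hq 1 0) b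
    rwa [PReg_zero_zero hq, one_mul, PReg_comm] at h
  have h := eq_mul_theta_of_functional_equation hq
    (fun x => PReg_one_add_eq hq0 hq x b) (tendsto_PReg_zero hq 1 b) a
  rw [h, h0, mul_comm]

lemma theta_div (hq0 : q ≠ 0) (hq : ‖q‖ < 1) (x : ℂ) :
    theta q (x / q) = 1 - x / q * theta q x := by
  rw [theta_eq_one_sub hq, div_mul_cancel₀ x hq0]

lemma sub_mul_PReg_two (hq0 : q ≠ 0) (hq : ‖q‖ < 1) (a b : ℂ) :
    (b - a) * PReg 2 q a b = b * theta q b - a * theta q a := by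
  rw [sub_mul_PReg_succ hq0 hq 1, PReg_one_eq hq0 hq, PReg_one_eq hq0 hq, theta_div hq0 hq,
    theta_div hq0 hq]
  ring

lemma thetaCombination_eq (hq0 : q ≠ 0) (hq : ‖q‖ < 1) {a b : ℂ} (ha : a ≠ 0) (hb : b ≠ 0)
    (hab : a + b ≠ 0) :
    thetaCombination q a b =
      -((a - b) * (a - b * q) * (b - a * q) / (a * b * (a + b) * (1 + q))) * PReg 3 q a b := by
  have hq2 : 1 + q ≠ 0 := by
    intro h
    rw [← neg_eq_of_add_eq_zero_right h, norm_neg, norm_one] at hq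
    exact lt_irrefl _ hq
  have h3 := sub_mul_PReg_succ hq0 hq 2 a b
  have h1 := sub_mul_PReg_two hq0 hq (a / q) b
  have h2 := sub_mul_PReg_two hq0 hq a (b / q)
  rw [theta_div hq0 hq] at h1 h2
  rw [thetaCombination, theta_div hq0 hq, theta_div hq0 hq]
  generalize theta q a = x at *
  generalize theta q b = y at *
  generalize PReg (2 + 1) q a b = p at *
  generalize PReg 2 q (a / q) b = r at *
  generalize PReg 2 q a (b / q) = s at *
  have h1' : (b * q - a) * r = q * b * y - a * (1 - a / q * x) := by
    field_simp at h1 ⊢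
    linear_combination h1
  have h2' : (b - a * q) * s = b * (1 - b / q * y) - a * q * x := by
    field_simp at h2 ⊢
    linear_combination h2
  -- Multiplying contiguity by `(a - bq)(b - aq)` eliminates `r` and `s` without division, so `a =
  -- b`, `a = bq` and `b = aq` need no separate treatment.
  have h : -((a - b) * (a - b * q) * (b - a * q) * p) =
      b * (b - a * q) * (a * (1 - a / q * x) - q * b * y)
        - a * (a - b * q) * (b * (1 - b / q * y) - a * q * x) := by
    linear_combination (a - b * q) * (b - a * q) * h3 - b * (b - a * q) * h1'
      - a * (a - b * q) * h2'
  rw [neg_mul, div_mul_eq_mul_div _ _ p, ← neg_div, h]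
  field_simp
  ring

/-! ### Agreement of the literal and cancelled series -/

lemma PTerm_mul_eq_PRegTerm (hq : ‖q‖ < 1) {m : ℕ} {a b : ℂ} (ha : ∀ k : ℕ, a * q ^ k ≠ 1)
    (hb : ∀ k : ℕ, b * q ^ k ≠ 1) (hab : ∀ k : ℕ, a * b / q ^ m * q ^ k ≠ 1) (n : ℕ) :
    qPochInf q q * qPochInf a q * qPochInf b q * PTerm m q a b n = PRegTerm m q a b n := by
  have h1 := qPoch_ne_zero (self_mul_pow_ne_one hq) n
  have h2 := qPoch_ne_zero ha n
  have h3 := qPoch_ne_zero hb n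
  have h4 := qPoch_ne_zero hab n
  rw [PTerm, PRegTerm, two_mul, qPoch_add, qPochInf_eq_qPoch_mul hq q n,
    qPochInf_eq_qPoch_mul hq a n, qPochInf_eq_qPoch_mul hq b n]
  generalize qPoch (a * b / q ^ m) q n = c at *
  field_simp

lemma summable_PTerm (hq : ‖q‖ < 1) {m : ℕ} {a b : ℂ} (ha : ∀ k : ℕ, a * q ^ k ≠ 1)
    (hb : ∀ k : ℕ, b * q ^ k ≠ 1) (hab : ∀ k : ℕ, a * b / q ^ m * q ^ k ≠ 1) :
    Summable (PTerm m q a b) := by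
  have hK : qPochInf q q * qPochInf a q * qPochInf b q ≠ 0 :=
    mul_ne_zero (mul_ne_zero (qPochInf_ne_zero hq (self_mul_pow_ne_one hq))
      (qPochInf_ne_zero hq ha)) (qPochInf_ne_zero hq hb)
  rw [← summable_mul_left_iff hK]
  exact (summable_PRegTerm hq m a b).congr fun n => (PTerm_mul_eq_PRegTerm hq ha hb hab n).symm

lemma P_eq_PReg (hq : ‖q‖ < 1) {m : ℕ} {a b : ℂ} (ha : ∀ k : ℕ, a * q ^ k ≠ 1)
    (hb : ∀ k : ℕ, b * q ^ k ≠ 1) (hab : ∀ k : ℕ, a * b / q ^ m * q ^ k ≠ 1) :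
    P m q a b = PReg m q a b := by
  rw [P, PReg, ← tsum_mul_left]
  exact tsum_congr (PTerm_mul_eq_PRegTerm hq ha hb hab)

end PReg

end PartialTheta

theorem mainTheorem4 (q : ℂ) (hq0 : q ≠ 0) (hq1 : ‖q‖ < 1)
    (a b : ℂ) (ha : a ≠ 0) (hb : b ≠ 0) (hab : a + b ≠ 0) :
    -- all the infinite products and series that occur converge
    (∀ x : ℂ, Multipliable (fun i : ℕ => 1 - x * q ^ i)) ∧
    (∀ x : ℂ, Summable (PartialTheta.thetaTerm q x)) ∧
    -- the identity with `P_3(a,b)` as written, when no denominator in it vanishes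
    ((∀ k : ℕ, a * q ^ k ≠ 1) → (∀ k : ℕ, b * q ^ k ≠ 1) →
        (∀ k : ℕ, a * b / q ^ 3 * q ^ k ≠ 1) →
      Summable (PartialTheta.PTerm 3 q a b) ∧
      PartialTheta.thetaCombination q a b =
        -((a - b) * (a - b * q) * (b - a * q) / (a * b * (a + b) * (1 + q))) *
          PartialTheta.P 3 q a b) ∧
    -- the identity for all `a`, `b`, with the removable singularities of `P_3(a,b)` removed
    (Summable (PartialTheta.PRegTerm 3 q a b) ∧
      PartialTheta.thetaCombination q a b =
        -((a - b) * (a - b * q) * (b - a * q) / (a * b * (a + b) * (1 + q))) *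
          PartialTheta.PReg 3 q a b) := by
  refine ⟨PartialTheta.multipliable_one_sub_mul_pow hq1, PartialTheta.summable_thetaTerm hq1,
    fun h1 h2 h3 => ⟨PartialTheta.summable_PTerm hq1 h1 h2 h3, ?_⟩,
    PartialTheta.summable_PRegTerm hq1 3 a b,
    PartialTheta.thetaCombination_eq hq0 hq1 ha hb hab⟩
  rw [PartialTheta.P_eq_PReg hq1 h1 h2 h3]
  exact PartialTheta.thetaCombination_eq hq0 hq1 ha hb hab
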